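/- A \emph{source of qubit states} is a sequence $(\rho_n)_n$ in which $\rho_n$ is a density matrix on $(\mathbb{C}^2)^{\otimes n}$. For $I\subseteq[n]$ let $(\rho_n)_I=\operatorname{Tr}_{I^c}[\rho_n]$ denote the reduced state on the qubits in $I$, and let $\|\cdot\|_1$ denote the trace norm. The source $(\rho_n)_n$ is called \emph{weakly almost i.i.d.\ along} a qubit state $\rho$ if, for every integer $k\ge 1$, $$\limsup_{n\to\infty}\ \frac{1}{\binom nk}\sum_{I\subseteq[n],\ |I|=k}\big\|(\rho_n)_I-\rho^{\otimes I}\big\|_1=0 .$$ \textbf{Lemma.} There exists a sequence $(\Psi_n)_n$ of pure states $\Psi_n$ of $n$ qubits such that, for all sufficiently large $n$, the reduced state $(\Psi_n)_I$ is maximally mixed, i.e. $(\Psi_n)_I=2^{-|I|}\,\mathbb{1}$, for every $I\subseteq[n]$ with $|I|\le 0.189\,n$. Moreover, every such sequence $(\Psi_n)_n$ is a weakly almost i.i.d.\ source along the maximally mixed qubit state $\tfrac12\mathbb{1}$. -/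

import Mathlib

open Filter
open scoped Matrix ComplexOrder

noncomputable section

/-- Density matrices (quantum states) on the Hilbert space `ℂ^ι`. -/
def IsDensityMatrix {ι : Type*} [Fintype ι] (ρ : Matrix ι ι ℂ) : Prop :=
  ρ.PosSemidef ∧ ρ.trace = 1

/-- Pure states: the rank-one projections `|ψ⟩⟨ψ|` onto unit vectors `ψ ∈ ℂ^ι`. -/
def IsPureState {ι : Type*} [Fintype ι] (ρ : Matrix ι ι ℂ) : Prop :=
  ∃ ψ : EuclideanSpace ℂ ι, ‖ψ‖ = 1 ∧ ∀ s t, ρ s t = ψ s * star (ψ t)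

/-- The maximally mixed state `1 / dim` on `ℂ^ι`. -/
def maximallyMixed (ι : Type*) [Fintype ι] [DecidableEq ι] : Matrix ι ι ℂ :=
  (Fintype.card ι : ℂ)⁻¹ • 1

/-- The trace norm `‖A‖₁ = Tr √(A† A)`: the sum of the singular values of `A`, i.e. of the
square roots of the eigenvalues of `A† A`, counted with multiplicity. -/
def traceNorm {ι : Type*} [Fintype ι] [DecidableEq ι] (A : Matrix ι ι ℂ) : ℝ :=
  ∑ i, √((Matrix.isHermitian_conjTranspose_mul_self A).eigenvalues i)

/-- The basis label of an `n`-partite system obtained from a label `s` of the parties in `I` and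
a label `u` of the parties in the complement of `I`. -/
def glue {ι : Type*} {n : ℕ} (I : Finset (Fin n)) (s : I → ι)
    (u : {i : Fin n // i ∉ I} → ι) : Fin n → ι :=
  fun i => if h : i ∈ I then s ⟨i, h⟩ else u ⟨i, h⟩

/-- The reduced state `ρ_I = Tr_{I^c} ρ` of an operator on `(ℂ^ι)^{⊗ n}`; the product basis of
the latter space is indexed by `Fin n → ι`. -/
def reducedState {ι : Type*} [Fintype ι] {n : ℕ}
    (ρ : Matrix (Fin n → ι) (Fin n → ι) ℂ) (I : Finset (Fin n)) :
    Matrix (I → ι) (I → ι) ℂ :=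
  Matrix.of fun s t => ∑ u : {i : Fin n // i ∉ I} → ι, ρ (glue I s u) (glue I t u)

/-- The tensor power `ρ^{⊗ κ}`, with one factor for every element of the finite type `κ`. -/
def tensorPower {ι : Type*} (ρ : Matrix ι ι ℂ) (κ : Type*) [Fintype κ] :
    Matrix (κ → ι) (κ → ι) ℂ :=
  Matrix.of fun s t => ∏ i, ρ (s i) (t i)

/-- The expectation of `f I`, for `I` uniformly distributed over the `k`-element subsets of
`[n]`. -/
def subsetAverage (n k : ℕ) (f : Finset (Fin n) → ℝ) : ℝ :=
  (n.choose k : ℝ)⁻¹ * ∑ I ∈ Finset.powersetCard k (Finset.univ : Finset (Fin n)), f I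

/-- `(ρ_n)_n` is a weakly almost i.i.d. source along the state `ρ`. The limit superior is taken
in the extended reals. -/
def IsWeaklyAlmostIID {ι : Type*} [Fintype ι] [DecidableEq ι] (ρ : Matrix ι ι ℂ)
    (ρs : (n : ℕ) → Matrix (Fin n → ι) (Fin n → ι) ℂ) : Prop :=
  IsDensityMatrix ρ ∧ (∀ n, IsDensityMatrix (ρs n)) ∧
    ∀ k : ℕ, 1 ≤ k →
      limsup (fun n : ℕ =>
        ((subsetAverage n k fun I =>
          traceNorm (reducedState (ρs n) I - tensorPower ρ I) : ℝ) : EReal)) atTop = 0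

/-- A sequence of pure `n`-qubit states such that, for all sufficiently large `n`, the marginal
on every set of at most `0.189 n` qubits is maximally mixed. -/
def IsLocallyMaximallyMixedSource
    (Ψ : (n : ℕ) → Matrix (Fin n → Fin 2) (Fin n → Fin 2) ℂ) : Prop :=
  (∀ n, IsPureState (Ψ n)) ∧
    ∀ᶠ n : ℕ in atTop, ∀ I : Finset (Fin n), (I.card : ℝ) ≤ 0.189 * (n : ℝ) →
      reducedState (Ψ n) I = maximallyMixed (I → Fin 2)

end

/-! For existence, use random graph states: amplitudes `2^(-n/2) (-1)^(q(x))` with `q(x) = xᵀ A x`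
over `ZMod 2`. If `s ≠ t` are labels on `I` with difference `v`, flipping an outside bit `i` changes
the sign of the summand in the partial trace by `(-1)^((M v) i)`, where `M = symmetrization A`. So
the marginal on `I` is maximally mixed once no nonzero `v` supported in `I` has `M v` supported in
`I` (`reducedState_graphState`). A union bound finds such an `A`: for `v ≠ 0` each equation `M v =
w` holds for at most a `2^(-n)` fraction of matrices (`card_symmetrization_fiber_mul_le`), and fewer
than `2^n` pairs `(v, w)` have joint support of size at most `0.189 n` (`card_small_support_lt`).
The second claim is immediate: a fixed `k` is eventually below `0.189 n`, so every summand vanishes.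
-/

section Counting

/-- Generating-function bound for the number of words over `ZMod 2 × ZMod 2` of small weight. -/
theorem card_small_support_mul_pow_le (n d : ℕ) {x : ℝ} (hx0 : 0 ≤ x) (hx1 : x ≤ 1) :
    ((Finset.univ.filter fun f : Fin n → ZMod 2 × ZMod 2 =>
      (Finset.univ.filter fun i => f i ≠ 0).card ≤ d).card : ℝ) * x ^ d ≤ (1 + 3 * x) ^ n := by
  have hsum : (∑ a : ZMod 2 × ZMod 2, if a ≠ 0 then x else 1) = 1 + 3 * x := by
    rw [Finset.sum_ite, Finset.sum_const, Finset.sum_const]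
    have h1 : (Finset.univ.filter fun a : ZMod 2 × ZMod 2 => a ≠ 0).card = 3 := by decide
    have h2 : (Finset.univ.filter fun a : ZMod 2 × ZMod 2 => ¬ a ≠ 0).card = 1 := by decide
    rw [h1, h2]
    simp only [nsmul_eq_mul]
    push_cast
    ring
  -- Expanding the power gives the weight enumerator, the sum of `x ^ weight` over all words.
  have hpow := Fintype.sum_pow (fun a : ZMod 2 × ZMod 2 => if a ≠ 0 then x else 1) n
  rw [hsum] at hpow
  rw [hpow, ← nsmul_eq_mul, ← Finset.sum_const]
  have hprod (f : Fin n → ZMod 2 × ZMod 2) : (∏ i, if f i ≠ 0 then x else 1) =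
      x ^ (Finset.univ.filter fun i => f i ≠ 0).card := by
    rw [Finset.prod_ite, Finset.prod_const, Finset.prod_const_one, mul_one]
  calc _ ≤ ∑ f ∈ Finset.univ.filter fun f : Fin n → ZMod 2 × ZMod 2 =>
        (Finset.univ.filter fun i => f i ≠ 0).card ≤ d, ∏ i, (if f i ≠ 0 then x else 1) := by
        refine Finset.sum_le_sum fun f hf => ?_
        rw [hprod]
        exact pow_le_pow_of_le_one hx0 hx1 (Finset.mem_filter.1 hf).2
    _ ≤ _ := by
        refine Finset.sum_le_sum_of_subset_of_nonneg (Finset.subset_univ _) fun f _ _ => ?_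
        rw [hprod]
        positivity

set_option exponentiation.threshold 2000 in
-- This is `h(0.189) + 0.189 log₂ 3 < 1` in rational form. The near-optimal parameter is `x = 7/90 ≈
-- δ / (3 (1 - δ))` for `δ = 0.189`, with `1 + 3x = 37/30`.
theorem entropy_estimate : (37 / 30 : ℝ) ^ 1000 < 2 ^ 1000 * (7 / 90 : ℝ) ^ 189 := by
  norm_num

/-- The Gilbert–Varshamov count for relative weight `0.189`. -/
theorem card_small_support_lt {n d : ℕ} (hn : n ≠ 0) (hd : (d : ℝ) ≤ 0.189 * n) :
    (Finset.univ.filter fun f : Fin n → ZMod 2 × ZMod 2 =>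
      (Finset.univ.filter fun i => f i ≠ 0).card ≤ d).card < 2 ^ n := by
  have h := card_small_support_mul_pow_le n d (x := 7 / 90) (by norm_num) (by norm_num)
  set N := (Finset.univ.filter fun f : Fin n → ZMod 2 × ZMod 2 =>
      (Finset.univ.filter fun i => f i ≠ 0).card ≤ d).card
  have hd' : d * 1000 ≤ 189 * n := by
    have : (d * 1000 : ℝ) ≤ 189 * n := by linarith
    exact_mod_cast this
  by_contra! hN
  have hN' : (2 : ℝ) ^ n ≤ N := by exact_mod_cast hN
  have h1 : (2 : ℝ) ^ n * (7 / 90) ^ d ≤ (37 / 30) ^ n := by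
    refine (mul_le_mul_of_nonneg_right hN' (by positivity)).trans (h.trans_eq ?_)
    norm_num
  -- The 1000th power makes the exponent `0.189 n` integral.
  have h2 := pow_le_pow_left₀ (by positivity) h1 1000
  have h3 : ((37 / 30 : ℝ) ^ 1000) ^ n < (2 ^ 1000 * (7 / 90 : ℝ) ^ 189) ^ n :=
    pow_lt_pow_left₀ entropy_estimate (pow_nonneg (by norm_num) _) hn
  have h4 : (7 / 90 : ℝ) ^ (189 * n) ≤ (7 / 90 : ℝ) ^ (d * 1000) :=
    pow_le_pow_of_le_one (by norm_num) (by norm_num) hd'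
  rw [mul_pow, ← pow_mul, ← pow_mul, ← pow_mul] at h2
  rw [mul_pow, ← pow_mul, ← pow_mul, ← pow_mul, mul_comm 1000 n] at h3
  have h5 := mul_le_mul_of_nonneg_left h4 (pow_nonneg (zero_le_two (α := ℝ)) (n * 1000))
  exact absurd (h3.trans_le (h5.trans h2)) (lt_irrefl _)

end Counting

/-! ### Random symmetric matrices over `ZMod 2` -/

section Symmetrization

variable {n : ℕ}

/-- The symmetric matrix with off-diagonal part `A + Aᵀ` and with the diagonal of `A`. -/
def symmetrization (A : Matrix (Fin n) (Fin n) (ZMod 2)) : Matrix (Fin n) (Fin n) (ZMod 2) :=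
  Matrix.of fun i j => if i = j then A i i else A i j + A j i

theorem symmetrization_add (A B : Matrix (Fin n) (Fin n) (ZMod 2)) :
    symmetrization (A + B) = symmetrization A + symmetrization B := by
  ext i j
  by_cases h : i = j
  · simp [symmetrization, h]
  · simp [symmetrization, h]
    ring

/-- The free diagonal is essential: an alternating `M` would force `vᵀ M v = 0`. -/
theorem exists_symmetrization_mulVec_eq {v : Fin n → ZMod 2} (hv : v ≠ 0) (w : Fin n → ZMod 2) :
    ∃ A, (symmetrization A).mulVec v = w := by
  obtain ⟨k, hk⟩ := Function.ne_iff.1 hv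
  have hk1 : v k = 1 := by
    have : ∀ a : ZMod 2, a ≠ 0 → a = 1 := by decide
    exact this _ hk
  -- Only column `k` is used: off the diagonal it contributes `w i * v k = w i`, and its diagonal
  -- entry cancels what symmetry adds to row `k`.
  refine ⟨Matrix.of fun i j => if j = k then
    (if i = k then w k - ∑ l ∈ Finset.univ.erase k, w l * v l else w i) else 0, ?_⟩
  ext i
  rw [Matrix.mulVec, dotProduct, ← Finset.add_sum_erase _ _ (Finset.mem_univ k), hk1, mul_one]
  by_cases hi : i = k
  · subst hi
    have : ∀ l ∈ Finset.univ.erase i, symmetrization (Matrix.of fun a j => if j = i then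
        (if a = i then w i - ∑ l ∈ Finset.univ.erase i, w l * v l else w a) else 0) i l * v l
        = w l * v l := by
      intro l hl
      have hl' : l ≠ i := Finset.ne_of_mem_erase hl
      simp [symmetrization, hl', hl'.symm]
    rw [Finset.sum_congr rfl this]
    simp [symmetrization]
  · have : ∀ l ∈ Finset.univ.erase k, symmetrization (Matrix.of fun a j => if j = k then
        (if a = k then w k - ∑ l ∈ Finset.univ.erase k, w l * v l else w a) else 0) i l * v l
        = 0 := by
      intro l hl
      have hl' : l ≠ k := Finset.ne_of_mem_erase hl
      simp [symmetrization, hl', hi]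
    rw [Finset.sum_eq_zero this]
    simp [symmetrization, hi]

/-- The fiber has `2 ^ n` pairwise disjoint translates, one by a preimage of each vector `y`. -/
theorem card_symmetrization_fiber_mul_le {v : Fin n → ZMod 2} (hv : v ≠ 0)
    (w : Fin n → ZMod 2) :
    (Finset.univ.filter fun A : Matrix (Fin n) (Fin n) (ZMod 2) =>
      (symmetrization A).mulVec v = w).card * 2 ^ n
      ≤ Fintype.card (Matrix (Fin n) (Fin n) (ZMod 2)) := by
  choose g hg using exists_symmetrization_mulVec_eq hv
  have hcard : 2 ^ n = (Finset.univ : Finset (Fin n → ZMod 2)).card := by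
    simp [ZMod.card]
  rw [hcard, ← Finset.card_product, ← Finset.card_univ]
  refine Finset.card_le_card_of_injOn (fun p => p.1 + g p.2) (fun _ _ => Finset.mem_coe.2
    (Finset.mem_univ _)) ?_
  rintro ⟨A, y⟩ hA ⟨B, z⟩ hB hAB
  have hA' : (symmetrization A).mulVec v = w := by simpa using hA
  have hB' : (symmetrization B).mulVec v = w := by simpa using hB
  have hAB' : A + g y = B + g z := hAB
  have h := congrArg (fun M => (symmetrization M).mulVec v) hAB'
  simp only [symmetrization_add, Matrix.add_mulVec, hA', hB', hg] at h
  obtain rfl : y = z := add_left_cancel h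
  rw [add_right_cancel hAB']

/-- A Gilbert–Varshamov argument: some matrix maps no nonzero vector `v` supported on a set of
at most `0.189 n` coordinates to a vector supported on the same set. -/
theorem exists_symmetrization_expanding (hn : n ≠ 0) :
    ∃ A : Matrix (Fin n) (Fin n) (ZMod 2), ∀ I : Finset (Fin n), (I.card : ℝ) ≤ 0.189 * n →
      ∀ v : Fin n → ZMod 2, v ≠ 0 → (∀ i ∉ I, v i = 0) →
        ∃ i ∉ I, (symmetrization A).mulVec v i ≠ 0 := by
  set d := ⌊(0.189 * n : ℝ)⌋₊
  have hd : (d : ℝ) ≤ 0.189 * n := Nat.floor_le (by positivity)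
  set S := Finset.univ.filter fun f : Fin n → ZMod 2 × ZMod 2 =>
      (Finset.univ.filter fun i => f i ≠ 0).card ≤ d with hS
  have hScard : S.card < 2 ^ n := card_small_support_lt hn hd
  -- A word `f` encodes a pair `(v, w)`; its weight is the size of the joint support.
  set bad := (S.filter fun f => (fun i => (f i).1) ≠ 0).biUnion fun f =>
    Finset.univ.filter fun A : Matrix (Fin n) (Fin n) (ZMod 2) =>
      (symmetrization A).mulVec (fun i => (f i).1) = fun i => (f i).2 with hbad
  have hlt : bad.card < (Finset.univ : Finset (Matrix (Fin n) (Fin n) (ZMod 2))).card := by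
    refine lt_of_mul_lt_mul_right (a := 2 ^ n) ?_ (Nat.zero_le _)
    calc bad.card * 2 ^ n ≤ (∑ f ∈ S.filter fun f => (fun i => (f i).1) ≠ 0,
          (Finset.univ.filter fun A : Matrix (Fin n) (Fin n) (ZMod 2) =>
            (symmetrization A).mulVec (fun i => (f i).1) = fun i => (f i).2).card) * 2 ^ n :=
          Nat.mul_le_mul_right _ Finset.card_biUnion_le
      _ ≤ ∑ f ∈ S.filter fun f => (fun i => (f i).1) ≠ 0,
          Fintype.card (Matrix (Fin n) (Fin n) (ZMod 2)) := by
          rw [Finset.sum_mul]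
          exact Finset.sum_le_sum fun f hf =>
            card_symmetrization_fiber_mul_le (Finset.mem_filter.1 hf).2 _
      _ ≤ S.card * Fintype.card (Matrix (Fin n) (Fin n) (ZMod 2)) := by
          rw [Finset.sum_const, smul_eq_mul]
          exact Nat.mul_le_mul_right _ (Finset.card_filter_le _ _)
      _ < _ := by
          rw [Finset.card_univ, mul_comm]
          exact Nat.mul_lt_mul_of_pos_left hScard Fintype.card_pos
  obtain ⟨A, -, hA⟩ := Finset.exists_mem_notMem_of_card_lt_card hlt
  refine ⟨A, fun I hI v hv hvI => ?_⟩
  by_contra! hcon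
  refine hA (Finset.mem_biUnion.2 ⟨fun i => (v i, (symmetrization A).mulVec v i), ?_, ?_⟩)
  · refine Finset.mem_filter.2 ⟨Finset.mem_filter.2 ⟨Finset.mem_univ _, ?_⟩, hv⟩
    refine (Finset.card_le_card fun i hi => ?_).trans (Nat.le_floor hI)
    by_contra hiI
    exact (Finset.mem_filter.1 hi).2 (Prod.ext (hvI i hiI) (hcon i hiI))
  · exact Finset.mem_filter.2 ⟨Finset.mem_univ _, rfl⟩

end Symmetrization

/-! ### Graph states and their marginals -/

section GraphState

variable {n : ℕ}

/-- The nontrivial character of `ZMod 2`. -/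
def signChar (a : ZMod 2) : ℂ := if a = 0 then 1 else -1

theorem signChar_add (a b : ZMod 2) : signChar (a + b) = signChar a * signChar b := by
  have h : ∀ a : ZMod 2, a = 0 ∨ a = 1 := by decide
  have h11 : (1 + 1 : ZMod 2) = 0 := by decide
  rcases h a with rfl | rfl <;> rcases h b with rfl | rfl <;> simp [signChar, h11]

theorem star_signChar (a : ZMod 2) : star (signChar a) = signChar a := by
  unfold signChar
  split_ifs <;> simp

theorem signChar_mul_self (a : ZMod 2) : signChar a * signChar a = 1 := by
  unfold signChar
  split_ifs <;> simp

/-- A computational basis label, read as a vector over `ZMod 2`. -/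
def bits (s : Fin n → Fin 2) (i : Fin n) : ZMod 2 := if s i = 0 then 0 else 1

/-- The quadratic form of `A`. -/
def quadForm (A : Matrix (Fin n) (Fin n) (ZMod 2)) (x : Fin n → ZMod 2) : ZMod 2 :=
  x ⬝ᵥ A.mulVec x

/-- The amplitudes of the graph state of `A`. -/
noncomputable def graphAmplitude (A : Matrix (Fin n) (Fin n) (ZMod 2)) (s : Fin n → Fin 2) : ℂ :=
  ((√(2 ^ n) : ℝ) : ℂ)⁻¹ * signChar (quadForm A (bits s))

/-- The graph state of `A` as a projection. -/
noncomputable def graphState (A : Matrix (Fin n) (Fin n) (ZMod 2)) :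
    Matrix (Fin n → Fin 2) (Fin n → Fin 2) ℂ :=
  Matrix.of fun s t => graphAmplitude A s * star (graphAmplitude A t)

theorem graphState_apply (A : Matrix (Fin n) (Fin n) (ZMod 2)) (s t : Fin n → Fin 2) :
    graphState A s t =
      (2 ^ n : ℂ)⁻¹ * signChar (quadForm A (bits s) + quadForm A (bits t)) := by
  have h : ((√(2 ^ n) : ℝ) : ℂ)⁻¹ * ((√(2 ^ n) : ℝ) : ℂ)⁻¹ = (2 ^ n : ℂ)⁻¹ := by
    rw [← mul_inv, ← Complex.ofReal_mul, Real.mul_self_sqrt (by positivity)]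
    push_cast
    rfl
  have hs : star (((√(2 ^ n) : ℝ) : ℂ)⁻¹) = ((√(2 ^ n) : ℝ) : ℂ)⁻¹ := by
    rw [← Complex.ofReal_inv]
    exact Complex.conj_ofReal _
  simp only [graphState, graphAmplitude, Matrix.of_apply, star_mul', star_signChar, hs,
    signChar_add, ← h]
  ring

theorem isPureState_graphState (A : Matrix (Fin n) (Fin n) (ZMod 2)) :
    IsPureState (graphState A) := by
  refine ⟨WithLp.toLp 2 (graphAmplitude A), ?_, fun s t => rfl⟩
  have hn (s : Fin n → Fin 2) : ‖graphAmplitude A s‖ ^ 2 = ((2 : ℝ) ^ n)⁻¹ := by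
    have h1 : ‖signChar (quadForm A (bits s))‖ = 1 := by
      unfold signChar
      split_ifs <;> simp
    rw [graphAmplitude, norm_mul, h1, mul_one, norm_inv, Complex.norm_real, inv_pow,
      Real.norm_of_nonneg (Real.sqrt_nonneg _), Real.sq_sqrt (by positivity)]
  rw [EuclideanSpace.norm_eq]
  simp [hn]

theorem quadForm_add (A : Matrix (Fin n) (Fin n) (ZMod 2)) (x y : Fin n → ZMod 2) :
    quadForm A (x + y) = quadForm A x + quadForm A y + (x ⬝ᵥ A.mulVec y + y ⬝ᵥ A.mulVec x) := by
  simp only [quadForm, Matrix.mulVec_add, dotProduct_add, add_dotProduct]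
  ring

/-- The polar form has matrix `A + Aᵀ`, whose diagonal is zero; since `v i = 0`, the different
diagonal of `symmetrization A` is not seen. -/
theorem polar_single_eq_symmetrization (A : Matrix (Fin n) (Fin n) (ZMod 2))
    {v : Fin n → ZMod 2} {i : Fin n} (hv : v i = 0) :
    v ⬝ᵥ A.mulVec (Pi.single i 1) + Pi.single i 1 ⬝ᵥ A.mulVec v =
      (symmetrization A).mulVec v i := by
  rw [single_one_dotProduct, Matrix.mulVec_single_one]
  simp only [Matrix.mulVec, dotProduct, ← Finset.sum_add_distrib]
  refine Finset.sum_congr rfl fun j _ => ?_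
  by_cases h : i = j
  · subst h
    simp [hv]
  · simp [symmetrization, h]
    ring

/-- The two copies of `q(e_i)` cancel in characteristic 2, leaving the polar form of `x + y` with
`e_i`. -/
theorem quadForm_flip (A : Matrix (Fin n) (Fin n) (ZMod 2)) {x y : Fin n → ZMod 2} {i : Fin n}
    (hxy : x i = y i) :
    quadForm A (x + Pi.single i 1) + quadForm A (y + Pi.single i 1) =
      quadForm A x + quadForm A y + (symmetrization A).mulVec (x + y) i := by
  have h0 : (x + y) i = 0 := by
    rw [Pi.add_apply, hxy, CharTwo.add_self_eq_zero]
  rw [← polar_single_eq_symmetrization A h0, quadForm_add, quadForm_add, add_dotProduct,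
    Matrix.mulVec_add, dotProduct_add]
  have h2 := CharTwo.add_self_eq_zero (quadForm A (Pi.single i 1))
  linear_combination h2

theorem bits_glue_update (I : Finset (Fin n)) (s : I → Fin 2) (u : {i : Fin n // i ∉ I} → Fin 2)
    (i : {i : Fin n // i ∉ I}) :
    bits (glue I s (Function.update u i (1 - u i))) =
      bits (glue I s u) + Pi.single i.1 1 := by
  ext j
  by_cases hj : j ∈ I
  · have hne : j ≠ i.1 := fun h => i.2 (h ▸ hj)
    simp [bits, glue, hj, hne]
  · by_cases hji : j = i.1
    · subst hji
      have : ∀ a : Fin 2, (if 1 - a = 0 then 0 else 1 : ZMod 2) = (if a = 0 then 0 else 1) + 1 := by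
        decide
      simpa [bits, glue, i.2] using this (u i)
    · have hne : (⟨j, hj⟩ : {i : Fin n // i ∉ I}) ≠ i := fun h => hji (congrArg Subtype.val h)
      simp [bits, glue, hj, hji, Function.update_of_ne hne]

theorem reducedState_graphState {A : Matrix (Fin n) (Fin n) (ZMod 2)} {I : Finset (Fin n)}
    (hA : ∀ v : Fin n → ZMod 2, v ≠ 0 → (∀ i ∉ I, v i = 0) →
      ∃ i ∉ I, (symmetrization A).mulVec v i ≠ 0) :
    reducedState (graphState A) I = maximallyMixed (I → Fin 2) := by
  ext s t
  simp only [reducedState, Matrix.of_apply, maximallyMixed, Matrix.smul_apply, smul_eq_mul,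
    graphState_apply, signChar_add]
  by_cases hst : s = t
  · subst hst
    simp only [signChar_mul_self, mul_one, Finset.sum_const, Matrix.one_apply_eq,
      Finset.card_univ, nsmul_eq_mul]
    have h1 : Fintype.card ({i : Fin n // i ∉ I} → Fin 2) * Fintype.card (I → Fin 2) = 2 ^ n := by
      simp only [Fintype.card_fun, Fintype.card_fin, ← pow_add]
      congr 1
      have := Fintype.card_subtype_compl (fun i => i ∈ I)
      have h2 := Finset.card_le_univ I
      simp only [Fintype.card_fin, Fintype.card_coe] at this h2 ⊢
      omega
    have h1' : (Fintype.card ({i : Fin n // i ∉ I} → Fin 2) : ℂ) * Fintype.card (I → Fin 2)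
        = 2 ^ n := by exact_mod_cast h1
    have h3 : (Fintype.card (I → Fin 2) : ℂ) ≠ 0 := Nat.cast_ne_zero.2 Fintype.card_ne_zero
    rw [← h1', mul_inv, ← mul_assoc, mul_inv_cancel₀, one_mul]
    exact Nat.cast_ne_zero.2 Fintype.card_ne_zero
  · rw [Matrix.one_apply_ne hst, mul_zero, ← Finset.mul_sum]
    have hout (u : {i : Fin n // i ∉ I} → Fin 2) (i : Fin n) (hi : i ∉ I) :
        bits (glue I s u) i = bits (glue I t u) i := by simp [bits, glue, hi]
    obtain ⟨j, hj⟩ := Function.ne_iff.1 hst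
    -- The outside label `0` is arbitrary: outside bits cancel in the sum.
    set v : Fin n → ZMod 2 := bits (glue I s 0) + bits (glue I t 0) with hv
    have hvu (u : {i : Fin n // i ∉ I} → Fin 2) :
        bits (glue I s u) + bits (glue I t u) = v := by
      ext i
      by_cases hi : i ∈ I
      · simp [hv, bits, glue, hi]
      · rw [hv, Pi.add_apply, Pi.add_apply, hout _ _ hi, hout _ _ hi, CharTwo.add_self_eq_zero,
          CharTwo.add_self_eq_zero]
    have hv0 : v ≠ 0 := by
      refine Function.ne_iff.2 ⟨j.1, ?_⟩
      have : ∀ a b : Fin 2, a ≠ b →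
          (if a = 0 then 0 else 1 : ZMod 2) + (if b = 0 then 0 else 1) ≠ 0 := by decide
      simpa [hv, bits, glue] using this _ _ hj
    obtain ⟨i, hi, hne⟩ := hA v hv0 fun i hi => by
      rw [hv, Pi.add_apply, hout _ _ hi, CharTwo.add_self_eq_zero]
    have hflip (u : {i : Fin n // i ∉ I} → Fin 2) :
        signChar (quadForm A (bits (glue I s u))) * signChar (quadForm A (bits (glue I t u))) +
        signChar (quadForm A (bits (glue I s (Function.update u ⟨i, hi⟩ (1 - u ⟨i, hi⟩))))) *
          signChar (quadForm A (bits (glue I t (Function.update u ⟨i, hi⟩ (1 - u ⟨i, hi⟩))))) =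
        0 := by
      rw [bits_glue_update I s u ⟨i, hi⟩, bits_glue_update I t u ⟨i, hi⟩, ← signChar_add,
        ← signChar_add, quadForm_flip A (hout u i hi), hvu, signChar_add (_ + _),
        show signChar ((symmetrization A).mulVec v i) = -1 from if_neg hne]
      ring
    -- Flipping bit `i` pairs the outside labels into summands of opposite sign.
    refine mul_eq_zero_of_right _ (Finset.sum_involution
      (fun u _ => Function.update u ⟨i, hi⟩ (1 - u ⟨i, hi⟩)) (fun u _ => hflip u)
      (fun u _ _ h => ?_) (fun _ _ => Finset.mem_univ _) (fun u _ => ?_))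
    · have h' := congrFun h ⟨i, hi⟩
      rw [Function.update_self] at h'
      have : ∀ a : Fin 2, 1 - a ≠ a := by decide
      exact this _ h'
    · simp

theorem exists_isLocallyMaximallyMixedSource :
    ∃ Ψ : (n : ℕ) → Matrix (Fin n → Fin 2) (Fin n → Fin 2) ℂ,
      IsLocallyMaximallyMixedSource Ψ := by
  have h (n : ℕ) : ∃ A : Matrix (Fin n) (Fin n) (ZMod 2), n ≠ 0 →
      ∀ I : Finset (Fin n), (I.card : ℝ) ≤ 0.189 * n →
        ∀ v : Fin n → ZMod 2, v ≠ 0 → (∀ i ∉ I, v i = 0) →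
          ∃ i ∉ I, (symmetrization A).mulVec v i ≠ 0 := by
    by_cases hn : n = 0
    · exact ⟨0, fun h => absurd hn h⟩
    · exact (exists_symmetrization_expanding hn).imp fun A hA _ => hA
  choose A hA using h
  refine ⟨fun n => graphState (A n), fun n => isPureState_graphState _, ?_⟩
  filter_upwards [eventually_ne_atTop 0] with n hn I hI
  exact reducedState_graphState (hA n hn I hI)

end GraphState

/-! ### From exact local mixedness to the weak i.i.d. property -/

section WeaklyAlmostIID

theorem IsPureState.isDensityMatrix {ι : Type*} [Fintype ι] {ρ : Matrix ι ι ℂ}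
    (h : IsPureState ρ) : IsDensityMatrix ρ := by
  obtain ⟨ψ, hψ, hρ⟩ := h
  have hρ' : ρ = Matrix.vecMulVec (fun i => ψ i) (star fun i => ψ i) := by
    ext s t
    exact hρ s t
  refine ⟨hρ' ▸ Matrix.posSemidef_vecMulVec_self_star _, ?_⟩
  have h2 : ∑ i, ‖ψ i‖ ^ 2 = 1 := by
    rw [← EuclideanSpace.norm_sq_eq, hψ, one_pow]
  have h3 (i : ι) : ρ i i = ((‖ψ i‖ ^ 2 : ℝ) : ℂ) := by
    rw [hρ]
    push_cast
    exact Complex.mul_conj' _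
  simp only [Matrix.trace, Matrix.diag_apply, h3]
  rw [← Complex.ofReal_sum, h2,
    Complex.ofReal_one]

theorem isDensityMatrix_maximallyMixed (ι : Type*) [Fintype ι] [DecidableEq ι] [Nonempty ι] :
    IsDensityMatrix (maximallyMixed ι) := by
  refine ⟨Matrix.PosSemidef.one.smul ?_, ?_⟩
  · rw [← Complex.ofReal_natCast, ← Complex.ofReal_inv]
    exact Complex.zero_le_real.2 (by positivity)
  · rw [maximallyMixed, Matrix.trace_smul, Matrix.trace_one, smul_eq_mul]
    exact inv_mul_cancel₀ (Nat.cast_ne_zero.2 Fintype.card_ne_zero)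

theorem tensorPower_maximallyMixed (ι κ : Type*) [Fintype ι] [DecidableEq ι] [Fintype κ]
    [DecidableEq κ] :
    tensorPower (maximallyMixed ι) κ = maximallyMixed (κ → ι) := by
  ext s t
  simp only [tensorPower, maximallyMixed, Matrix.of_apply, Matrix.smul_apply, smul_eq_mul,
    Finset.prod_mul_distrib, Finset.prod_const, Finset.card_univ, Fintype.card_fun, Nat.cast_pow,
    inv_pow]
  congr 1
  by_cases h : s = t
  · subst h
    simp
  · obtain ⟨i, hi⟩ := Function.ne_iff.1 h
    rw [Matrix.one_apply_ne h]
    exact Finset.prod_eq_zero (Finset.mem_univ i) (Matrix.one_apply_ne hi)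

theorem traceNorm_zero {ι : Type*} [Fintype ι] [DecidableEq ι] :
    traceNorm (0 : Matrix ι ι ℂ) = 0 := by
  refine Finset.sum_eq_zero fun i _ => ?_
  have h : (Matrix.isHermitian_conjTranspose_mul_self (0 : Matrix ι ι ℂ)).eigenvalues = 0 :=
    (Matrix.IsHermitian.eigenvalues_eq_zero_iff _).2 (by simp)
  rw [h, Pi.zero_apply, Real.sqrt_zero]

theorem IsLocallyMaximallyMixedSource.isWeaklyAlmostIID
    {Ψ : (n : ℕ) → Matrix (Fin n → Fin 2) (Fin n → Fin 2) ℂ}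
    (h : IsLocallyMaximallyMixedSource Ψ) :
    IsWeaklyAlmostIID (maximallyMixed (Fin 2)) Ψ := by
  refine ⟨isDensityMatrix_maximallyMixed _, fun n => (h.1 n).isDensityMatrix, fun k _ => ?_⟩
  -- The averages are eventually equal to zero, so no estimate is needed.
  refine (limsup_congr ?_).trans (limsup_const (f := (atTop : Filter ℕ)) (0 : EReal))
  have hk : ∀ᶠ n : ℕ in atTop, (k : ℝ) ≤ 0.189 * n :=
    (tendsto_natCast_atTop_atTop.const_mul_atTop (by norm_num)).eventually_ge_atTop _
  filter_upwards [h.2, hk] with n hn hkn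
  rw [subsetAverage, Finset.sum_eq_zero, mul_zero, EReal.coe_zero]
  intro I hI
  have hcard : I.card = k := (Finset.mem_powersetCard.1 hI).2
  rw [hn I (by rwa [hcard]), tensorPower_maximallyMixed, sub_self, traceNorm_zero]

end WeaklyAlmostIID

theorem mainTheorem8 :
    (∃ Ψ : (n : ℕ) → Matrix (Fin n → Fin 2) (Fin n → Fin 2) ℂ,
      IsLocallyMaximallyMixedSource Ψ) ∧
    ∀ Ψ : (n : ℕ) → Matrix (Fin n → Fin 2) (Fin n → Fin 2) ℂ,
      IsLocallyMaximallyMixedSource Ψ →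
        IsWeaklyAlmostIID (maximallyMixed (Fin 2)) Ψ :=
  ⟨exists_isLocallyMaximallyMixedSource, fun _ h => h.isWeaklyAlmostIID⟩
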